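/- Let $t_0\in\mathbb R$, let $\mathcal D\subseteq\mathbb R^n$ be open and connected with $0\in\mathcal D$, and let $\Omega=\mathcal D\times[t_0,\infty)$. Let $F:\mathbb R^n\times[t_0,\infty)\rightrightarrows\mathbb R^n$ be a set-valued map with compact values. A solution of $\dot x\in F(x,t)$ over $[s,T)$, where $t_0\le s<T\le\infty$, is a locally absolutely continuous $x:[s,T)\to\mathbb R^n$ with $\dot x(t)\in F(x(t),t)$ for almost all $t\in[s,T)$. It is maximal if no solution over some $[s,T')$ with $T'>T$ extends it, and complete if $T=\infty$. Assume that * for every $(y,\tau)\in\Omega$ there is a solution with $x(\tau)=y$ over some $[\tau,T)$, $\tau<T<\infty$; * $F$ is locally bounded over $\Omega$, uniformly in $t$: for every compact $K\subset\mathcal D$ there is $M>0$ such that $\|y\|\le M$ whenever $x\in K$, $t\ge t_0$ and $y\in F(x,t)$. For a locally Lipschitz $U:\Omega\to\mathbb R$ let $\partial U(x,t)$ be the Clarke gradient, i.e. the closed convex hull of all limits of $\nabla U(x_i,t_i)$ along sequences $(x_i,t_i)\to(x,t)$ of points of the interior of $\Omega$ at which $U$ is differentiable. Call $U$ regular if at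 every $z$ in the interior of $\Omega$ and for every direction $w$ the one-sided directional derivative $\lim_{h\downarrow0}\frac{U(z+hw)-U(z)}h$ exists and equals $\limsup_{y\to z,\,h\downarrow0}\frac{U(y+hw)-U(y)}h$. Let $\mathcal U=\{U_i\}_{i=1}^\infty$ be a collection of locally Lipschitz regular functions $U_i:\Omega\to\mathbb R$, and let $$\tilde F_{\mathcal U}(x,t)=\bigcap_{i=1}^\infty\{q\in F(x,t)\mid \exists a\in\mathbb R\ \forall p\in\partial U_i(x,t):\ p^T[q;1]=a\}.$$ The $\mathcal U$-generalized derivative of a locally Lipschitz $V:\Omega\to\mathbb R$ is $$\dot{\overline V}_{\mathcal U}(x,t)=\begin{cases}\displaystyle\min_{p\in\partial V(x,t)}\ \max_{q\in\tilde F_{\mathcal U}(x,t)}p^T[q;1]&\text{if } V\text{ is regular},\\[1ex] \displaystyle\max_{p\in\partial V(x,t)}\ \max_{q\in\tilde F_{\mathcal U}(x,t)}p^T[q;1]&\text{if }V\text{ is not regular},\end{cases}$$ and it is $-\infty$ where $\tilde F_{\mathcal U}(x,t)=\emptyset$. Let $V:\Omega\to\mathbb R$ be locally Lipschitz and positive definite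 ($V(0,t)=0$, and $V(x,t)>0$ for $x\ne0$). Let $\underline W,\overline W:\mathcal D\to\mathbb R$ be continuous and positive definite, and let $W:\mathcal D\to\mathbb R$ be continuous and positive semidefinite ($W\ge0$ on $\mathcal D$), such that $$\underline W(x)\le V(x,t)\le\overline W(x)\quad\text{for all }(x,t)\in\Omega,$$ and, for almost all $t\ge t_0$, $$\dot{\overline V}_{\mathcal U}(x,t)\le -W(x)\quad\text{for all }x\in\mathcal D$$ (the exceptional null set of times does not depend on $x$). Let $r>0$ with $\overline{\mathrm B}(0,r)\subset\mathcal D$, let $0\le c<\min_{\|x\|=r}\underline W(x)$, and let $\Omega_c=\{x\in\overline{\mathrm B}(0,r)\mid\overline W(x)\le c\}$. Then every maximal solution $x:[s,T)\to\mathbb R^n$ of $\dot x\in F(x,t)$ with initial time $s\ge t_0$ and $x(s)\in\Omega_c$ is complete, stays in $\mathcal D$, is bounded, and satisfies $\lim_{t\to\infty}W(x(t))=0$. -/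

import Mathlib

open Filter Topology MeasureTheory

namespace DiffIncl

section Basic

variable {E : Type*} [NormedAddCommGroup E] [NormedSpace ℝ E]

/-- The right-open interval `[s, T)`, where `T = ⊤` gives `[s, ∞)`. -/
def timeInterval (s : ℝ) (T : EReal) : Set ℝ := {t : ℝ | s ≤ t ∧ (t : EReal) < T}

/-- `x` is locally absolutely continuous on `I`: it is absolutely continuous on every compact
interval contained in `I`. -/
def LocallyAC (x : ℝ → E) (I : Set ℝ) : Prop :=
  ∀ a b : ℝ, a ≤ b → Set.Icc a b ⊆ I → AbsolutelyContinuousOnInterval x a b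

/-- `x` is a solution of `ẋ ∈ F (x, t)` over the nondegenerate interval `[s, T)`. Only the values
of `x` on `[s, T)` matter. -/
def IsSolution (F : E → ℝ → Set E) (x : ℝ → E) (s : ℝ) (T : EReal) : Prop :=
  (s : EReal) < T ∧ LocallyAC x (timeInterval s T) ∧
    ∀ᵐ t : ℝ, t ∈ timeInterval s T → ∃ v ∈ F (x t) t, HasDerivAt x v t

/-- A maximal solution over `[s, T)`: it has no proper right extension that is a solution. -/
def IsMaximalSolution (F : E → ℝ → Set E) (x : ℝ → E) (s : ℝ) (T : EReal) : Prop :=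
  IsSolution F x s T ∧
    ¬ ∃ (T' : EReal) (y : ℝ → E), T < T' ∧ IsSolution F y s T' ∧ Set.EqOn y x (timeInterval s T)

/-- `F` admits local solutions over `D × J`: through every `(y, τ) ∈ D × J` there starts a
solution over some `[τ, T)`, `τ < T < ∞`. -/
def AdmitsLocalSolutions (F : E → ℝ → Set E) (D : Set E) (J : Set ℝ) : Prop :=
  ∀ y ∈ D, ∀ τ ∈ J, ∃ (T : ℝ) (x : ℝ → E), τ < T ∧ x τ = y ∧ IsSolution F x τ (T : EReal)

/-- `F` is locally bounded, uniformly in `t`, over `D × [t₀, ∞)`. -/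
def LocallyBoundedUniformly (F : E → ℝ → Set E) (D : Set E) (t₀ : ℝ) : Prop :=
  ∀ K : Set E, IsCompact K → K ⊆ D →
    ∃ M : ℝ, 0 < M ∧ ∀ x ∈ K, ∀ t : ℝ, t₀ ≤ t → ∀ y ∈ F x t, ‖y‖ ≤ M

/-- Positive definiteness on `D` of a function of the state. -/
def PosDefOn (D : Set E) (W : E → ℝ) : Prop :=
  W 0 = 0 ∧ ∀ x ∈ D, x ≠ 0 → 0 < W x

/-- The Clarke gradient at `z` of a locally Lipschitz function `V` with domain `Ω`: the closed
convex hull of all limits of gradients of `V` along sequences tending to `z` through points of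
the interior of `Ω` at which `V` is differentiable. A gradient `p` is represented by the linear
functional `w ↦ pᵀ w`. -/
def clarkeGradient (Ω : Set E) (V : E → ℝ) (z : E) : Set (E →L[ℝ] ℝ) :=
  closedConvexHull ℝ {p : E →L[ℝ] ℝ | ∃ u : ℕ → E,
    (∀ i, u i ∈ interior Ω ∧ DifferentiableAt ℝ V (u i)) ∧
    Tendsto u atTop (𝓝 z) ∧ Tendsto (fun i => fderiv ℝ V (u i)) atTop (𝓝 p)}

/-- Clarke's generalized directional derivative
`V°(z; w) = limsup_{y → z, h ↓ 0} (V (y + h w) - V y) / h`. -/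
noncomputable def clarkeDirDeriv (V : E → ℝ) (z w : E) : EReal :=
  limsup (fun q : E × ℝ => (((V (q.1 + q.2 • w) - V q.1) / q.2 : ℝ) : EReal))
    (𝓝 z ×ˢ 𝓝[>] (0 : ℝ))

/-- Clarke regularity at `z`: all one-sided directional derivatives exist and agree with the
generalized ones. -/
def IsRegularAt (V : E → ℝ) (z : E) : Prop :=
  ∀ w : E, ∃ d : ℝ, Tendsto (fun h : ℝ => (V (z + h • w) - V z) / h) (𝓝[>] 0) (𝓝 d) ∧
    clarkeDirDeriv V z w = (d : EReal)

/-- Regularity of a function with domain `Ω`, required at the points of `Ω` around which the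
function is defined in a full neighborhood. -/
def IsRegularOn (Ω : Set E) (V : E → ℝ) : Prop :=
  ∀ z ∈ interior Ω, IsRegularAt V z

end Basic

section Reduced

variable {E : Type*} [NormedAddCommGroup E] [NormedSpace ℝ E]

/-- The reduction of `H` by `U` at `(x, t)`: the directions `q ∈ H (x, t)` for which `pᵀ [q; 1]`
is the same number for all `p` in the Clarke gradient of `U`. -/
def reduction (Ω : Set (E × ℝ)) (H : E → ℝ → Set E) (U : E × ℝ → ℝ) (x : E) (t : ℝ) : Set E :=
  {q | q ∈ H x t ∧ ∃ a : ℝ, ∀ p ∈ clarkeGradient Ω U (x, t), p (q, 1) = a}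

/-- The `𝒰`-reduced differential inclusion, for a sequence `𝒰` of functions on `Ω`. -/
def reducedInclusion (Ω : Set (E × ℝ)) (F : E → ℝ → Set E) (U : ℕ → E × ℝ → ℝ)
    (x : E) (t : ℝ) : Set E :=
  ⋂ i, reduction Ω F (U i) x t

open Classical in
/-- The `𝒰`-generalized derivative of `V` in the directions `F`, with values in `[-∞, ∞]`:
the min-max of `pᵀ [q; 1]` over `p ∈ ∂V (x, t)` and `q` in the reduced inclusion if `V` is regular,
the max-max if it is not, and `-∞` if the reduced inclusion is empty. -/
noncomputable def genDeriv (Ω : Set (E × ℝ)) (F : E → ℝ → Set E) (U : ℕ → E × ℝ → ℝ)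
    (V : E × ℝ → ℝ) (x : E) (t : ℝ) : EReal :=
  if reducedInclusion Ω F U x t = ∅ then ⊥
  else if IsRegularOn Ω V then
    ⨅ p ∈ clarkeGradient Ω V (x, t), ⨆ q ∈ reducedInclusion Ω F U x t, ((p (q, 1) : ℝ) : EReal)
  else
    ⨆ p ∈ clarkeGradient Ω V (x, t), ⨆ q ∈ reducedInclusion Ω F U x t, ((p (q, 1) : ℝ) : EReal)

end Reduced

end DiffIncl

/-! Along a solution `x`, the functions `V (x t, t)` and `U i (x t, t)` are absolutely continuous.
Since the collection is countable, almost every `t` is a time at which all of them and `x` are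
differentiable. By the Lipschitz property, derivatives along the curve are then two-sided
directional derivatives in the direction `(ẋ, 1)`. For a regular function, every Clarke gradient
takes that value on `(ẋ, 1)` (`apply_eq_of_mem_clarkeGradient`), so `ẋ` lies in the reduced
inclusion. The same identity treats a regular `V`; for a non-regular `V` some Clarke gradient
dominates the derivative (`exists_mem_clarkeGradient_le`). Either way the derivative of `V` along
`x` is at most `genDeriv`, hence at most `-W` almost everywhere, and integration gives `V (x b, b) +
∫ W ≤ V (x s, s) ≤ c` as long as `x` stays in `D`.

On the sphere of radius `r`, `V ≥ Wlow > c`, so the solution never reaches it. In the ball `F` is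
bounded, so `x` is Lipschitz; at a finite end time it would have a limit in the ball and could be
continued, so `T = ⊤`. Finally `∫ W ≤ c` and `W ∘ x` is uniformly continuous, so Barbalat's lemma
applies. -/

namespace DiffIncl

/-! ### Absolutely continuous functions and curves -/

section AbsoluteContinuity

/-- A function whose increments are controlled by those of the identity and of an absolutely
continuous function is absolutely continuous. -/
theorem absolutelyContinuousOnInterval_of_dist_le {X Y : Type*} [PseudoMetricSpace X]
    [PseudoMetricSpace Y] {f : ℝ → X} {g : ℝ → Y} {a b : ℝ}
    (hg : AbsolutelyContinuousOnInterval g a b) (C C' : ℝ)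
    (h : ∀ u ∈ Set.uIcc a b, ∀ v ∈ Set.uIcc a b,
      dist (f u) (f v) ≤ C * dist u v + C' * dist (g u) (g v)) :
    AbsolutelyContinuousOnInterval f a b := by
  have hid : AbsolutelyContinuousOnInterval (fun t : ℝ => t) a b :=
    (LipschitzWith.id.lipschitzOnWith).absolutelyContinuousOnInterval
  refine squeeze_zero' (Eventually.of_forall fun _ => Finset.sum_nonneg fun _ _ => dist_nonneg) ?_
    (by simpa using (Tendsto.const_mul C hid).add (Tendsto.const_mul C' hg))
  filter_upwards [mem_inf_of_right (mem_principal_self _)] with P hP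
  rw [Finset.mul_sum, Finset.mul_sum, ← Finset.sum_add_distrib]
  exact Finset.sum_le_sum fun i hi => h _ (hP.1 i hi).1 _ (hP.1 i hi).2

/-- Freezing an absolutely continuous function before the left end of its interval keeps it
absolutely continuous. -/
theorem absolutelyContinuousOnInterval_comp_max {X : Type*} [PseudoMetricSpace X] {g : ℝ → X}
    {a b T : ℝ} (hab : a ≤ b) (hg : AbsolutelyContinuousOnInterval g T (max b T)) :
    AbsolutelyContinuousOnInterval (fun t => g (max t T)) a b := by
  rw [absolutelyContinuousOnInterval_iff] at hg ⊢
  intro ε hε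
  obtain ⟨δ, hδ, H⟩ := hg ε hε
  refine ⟨δ, hδ, fun P hP hPδ => ?_⟩
  -- Clamping the endpoints below at `T` keeps the intervals disjoint and does not lengthen them.
  refine H (P.1, fun i => (max (P.2 i).1 T, max (P.2 i).2 T)) ⟨fun i hi => ?_, ?_⟩ ?_
  · have := hP.1 i hi
    rw [Set.uIcc_of_le hab] at this
    rw [Set.uIcc_of_le (le_max_right b T)]
    exact ⟨⟨le_max_right _ _, max_le_max_right _ this.1.2⟩,
      ⟨le_max_right _ _, max_le_max_right _ this.2.2⟩⟩
  · refine hP.2.mono fun i u hu => ?_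
    simp only [Set.mem_uIoc, le_max_iff, max_lt_iff] at hu ⊢
    grind
  · refine lt_of_le_of_lt (Finset.sum_le_sum fun i _ => ?_) hPδ
    simp only [Real.dist_eq]
    simpa using abs_max_sub_max_le_max (P.2 i).1 T (P.2 i).2 T

/-- Integrating an almost everywhere bound for the derivative of an absolutely continuous
function. -/
theorem sub_le_integral_of_deriv_le {f g : ℝ → ℝ} {a b : ℝ} (hab : a ≤ b)
    (hf : AbsolutelyContinuousOnInterval f a b) (hg : IntervalIntegrable g volume a b)
    (h : ∀ᵐ t : ℝ, t ∈ Set.Icc a b → deriv f t ≤ g t) :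
    f b - f a ≤ ∫ t in a..b, g t := by
  rw [← hf.integral_deriv_eq_sub]
  exact intervalIntegral.integral_mono_ae_restrict hab hf.intervalIntegrable_deriv hg
    ((ae_restrict_iff' measurableSet_Icc).2 h)

/-- The mean value inequality for absolutely continuous curves. -/
theorem dist_le_of_ae_norm_deriv_le {E : Type*} [NormedAddCommGroup E] [NormedSpace ℝ E]
    {x : ℝ → E} {a b M : ℝ} (hab : a ≤ b) (hx : AbsolutelyContinuousOnInterval x a b)
    (h : ∀ᵐ t : ℝ, t ∈ Set.Icc a b → ∃ v, HasDerivAt x v t ∧ ‖v‖ ≤ M) :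
    dist (x a) (x b) ≤ M * (b - a) := by
  -- A norming functional of norm at most one reduces the estimate to real-valued functions.
  obtain ⟨l, hl, hlx⟩ := exists_dual_vector'' ℝ (x b - x a)
  have hac : AbsolutelyContinuousOnInterval (fun t => l (x t)) a b := by
    refine absolutelyContinuousOnInterval_of_dist_le hx 0 ‖l‖ fun u _ v _ => ?_
    simpa using l.dist_le_opNorm (x u) (x v)
  have key := sub_le_integral_of_deriv_le (g := fun _ => M) hab hac (by simp) (by
    filter_upwards [h] with t ht hmem
    obtain ⟨v, hv, hM⟩ := ht hmem
    have hd : deriv (fun t => l (x t)) t = l v := (l.hasFDerivAt.comp_hasDerivAt t hv).deriv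
    rw [hd]
    calc l v ≤ ‖l v‖ := le_abs_self _
      _ ≤ 1 * ‖v‖ := (l.le_opNorm v).trans (by gcongr)
      _ ≤ M := by simpa using hM)
  rw [dist_comm, dist_eq_norm]
  have e : l (x b) - l (x a) = ‖x b - x a‖ := by rw [← map_sub, hlx]; rfl
  simp only [e, intervalIntegral.integral_const, smul_eq_mul] at key
  linarith

end AbsoluteContinuity

/-! ### Clarke gradients and directional derivatives -/

section Clarke

variable {G : Type*} [NormedAddCommGroup G] [NormedSpace ℝ G]

/-- Elements of the Clarke gradient are dominated by the generalized directional derivative. -/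
theorem apply_le_of_mem_clarkeGradient {Ω : Set G} {V : G → ℝ} {z w : G} {d : ℝ}
    (hd : clarkeDirDeriv V z w ≤ (d : EReal)) {p : G →L[ℝ] ℝ} (hp : p ∈ clarkeGradient Ω V z) :
    p w ≤ d := by
  have hcont : Continuous fun q : G →L[ℝ] ℝ => q w := (ContinuousLinearMap.apply ℝ ℝ w).continuous
  suffices clarkeGradient Ω V z ⊆ {q | q w ≤ d} from this hp
  -- A half-space is closed and convex, so only limits of gradients need checking.
  refine closedConvexHull_min ?_ ?_ (isClosed_le hcont continuous_const)
  · rintro q ⟨u, hu, huz, huq⟩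
    change q w ≤ d
    refine le_of_forall_gt_imp_ge_of_dense fun d' hd' => ?_
    have hlt : ∀ᶠ r : G × ℝ in 𝓝 z ×ˢ 𝓝[>] (0 : ℝ),
        (((V (r.1 + r.2 • w) - V r.1) / r.2 : ℝ) : EReal) < d' :=
      eventually_lt_of_limsup_lt (hd.trans_lt (EReal.coe_lt_coe_iff.2 hd'))
    refine le_of_tendsto ((hcont.tendsto q).comp huq) ?_
    -- For each late `i` the quotient bound holds at `u i` for all small `h > 0`; letting `h ↓ 0`
    -- bounds the gradient there.
    filter_upwards [huz.eventually hlt.curry] with i hi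
    have hder : HasDerivAt (fun h : ℝ => V (u i + h • w)) (fderiv ℝ V (u i) w) 0 :=
      (hu i).2.hasFDerivAt.hasLineDerivAt w
    refine le_of_tendsto hder.tendsto_slope_zero_right ?_
    filter_upwards [hi] with h hh
    have := (EReal.coe_lt_coe_iff.1 hh).le
    simpa [div_eq_inv_mul] using this
  · exact convex_halfSpace_le (ContinuousLinearMap.apply ℝ ℝ w).toLinearMap.isLinear d

/-- Where a regular function has a two-sided derivative in a direction, all elements of the
Clarke gradient agree with it. -/
theorem apply_eq_of_mem_clarkeGradient {Ω : Set G} {V : G → ℝ} {z w : G} {d : ℝ}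
    (hV : IsRegularAt V z) (hd : HasLineDerivAt ℝ V d z w) {p : G →L[ℝ] ℝ}
    (hp : p ∈ clarkeGradient Ω V z) : p w = d := by
  have key : ∀ {w : G} {d : ℝ}, HasLineDerivAt ℝ V d z w → p w ≤ d := by
    intro w d hd
    obtain ⟨e, he, hce⟩ := hV w
    have h1 : Tendsto (fun h : ℝ => (V (z + h • w) - V z) / h) (𝓝[>] 0) (𝓝 d) := by
      simpa [div_eq_inv_mul] using HasDerivAt.tendsto_slope_zero_right hd
    rw [tendsto_nhds_unique h1 he]
    exact apply_le_of_mem_clarkeGradient hce.le hp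
  refine le_antisymm (key hd) ?_
  -- Reversing the direction negates a two-sided derivative and yields the opposite inequality.
  have h2 : HasLineDerivAt ℝ V (-d) z (-w) := by
    simpa using hd.smul (-1 : ℝ)
  have := key h2
  simp only [map_neg] at this
  linarith

/-- The derivative of a locally Lipschitz function along a curve is a directional derivative. -/
theorem hasLineDerivAt_of_hasDerivAt_comp {V : G → ℝ} {γ : ℝ → G} {w : G} {t d : ℝ}
    {K : NNReal} {s : Set G} (hs : s ∈ 𝓝 (γ t)) (hV : LipschitzOnWith K V s)
    (hγ : HasDerivAt γ w t) (hd : HasDerivAt (fun u => V (γ u)) d t) :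
    HasLineDerivAt ℝ V d (γ t) w := by
  have hd0 : HasDerivAt (fun h => V (γ (t + h))) d 0 := by
    have : HasDerivAt (fun u => V (γ u)) d (t + 0) := by simpa using hd
    exact this.comp_const_add t 0
  have hγ0 : HasDerivAt (fun h => γ (t + h)) w 0 := by
    have : HasDerivAt γ w (t + 0) := by simpa using hγ
    exact this.comp_const_add t 0
  have hl0 : HasDerivAt (fun h : ℝ => γ t + h • w) w 0 := by
    simpa using ((hasDerivAt_id (0 : ℝ)).smul_const w).const_add (γ t)
  -- The curve and its tangent line differ by `o(h)`, and the Lipschitz bound passes this on to `V`.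
  have hdiff : HasDerivAt (fun h : ℝ => V (γ t + h • w) - V (γ (t + h))) 0 0 := by
    have h0 := hl0.sub hγ0
    rw [sub_self] at h0
    rw [hasDerivAt_iff_isLittleO] at h0 ⊢
    refine Asymptotics.IsBigO.trans_isLittleO ?_ h0
    refine Asymptotics.IsBigO.of_bound K ?_
    have e1 : ∀ᶠ h in 𝓝 (0 : ℝ), γ t + h • w ∈ s := by
      apply hl0.continuousAt.eventually_mem; simpa using hs
    have e2 : ∀ᶠ h in 𝓝 (0 : ℝ), γ (t + h) ∈ s := by
      apply hγ0.continuousAt.eventually_mem; simpa using hs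
    filter_upwards [e1, e2] with h h1 h2
    simpa [dist_eq_norm] using hV.dist_le_mul _ h1 _ h2
  have := hdiff.fun_add hd0
  simpa [HasLineDerivAt] using this

variable [FiniteDimensional ℝ G]

/-- If all gradients of a Lipschitz function in a ball are at most `a` in the direction `w`, then
so are its difference quotients. -/
theorem sub_le_of_forall_fderiv_apply_le {f : G → ℝ} {K : NNReal} (hf : LipschitzWith K f)
    {z w : G} {δ a h : ℝ} (hfd : ∀ y ∈ Metric.ball z δ, DifferentiableAt ℝ f y → fderiv ℝ f y w ≤ a)
    (hh : 0 ≤ h) (hz : z ∈ Metric.ball z δ) (hzh : z + h • w ∈ Metric.ball z δ) :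
    f (z + h • w) - f z ≤ a * h := by
  let _ : MeasurableSpace G := borel G
  have : BorelSpace G := ⟨rfl⟩
  let L : ℝ →ₗ[ℝ] G := LinearMap.toSpanSingleton ℝ G w
  -- Rademacher and Fubini. The line through `z` itself may be exceptional, so `z` is later
  -- approximated by good base points.
  have hae : ∀ᵐ y ∂(Measure.addHaar : Measure G), ∀ᵐ τ : ℝ, DifferentiableAt ℝ f (y + τ • w) :=
    (ae_ae_add_linearMap_mem_iff L volume Measure.addHaar
      (measurableSet_of_differentiableAt ℝ f)).2 hf.ae_differentiableAt
  have hgood : ∀ y, (∀ᵐ τ : ℝ, DifferentiableAt ℝ f (y + τ • w)) → y ∈ Metric.ball z δ →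
      y + h • w ∈ Metric.ball z δ → f (y + h • w) - f y ≤ a * h := by
    intro y hy hyb hyh
    have hac : AbsolutelyContinuousOnInterval (fun τ : ℝ => f (y + τ • w)) 0 h := by
      refine LipschitzOnWith.absolutelyContinuousOnInterval (K := K * ‖w‖₊) ?_
      refine LipschitzWith.lipschitzOnWith (LipschitzWith.of_dist_le_mul fun u v => ?_)
      refine (hf.dist_le_mul _ _).trans ?_
      rw [dist_add_left, dist_eq_norm, ← sub_smul, norm_smul, dist_eq_norm]
      simp only [NNReal.coe_mul, coe_nnnorm]
      exact le_of_eq (by ring)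
    have := sub_le_integral_of_deriv_le (g := fun _ => a) hh hac (by simp) (by
      filter_upwards [hy] with τ hτ hmem
      have hd : HasDerivAt (fun τ : ℝ => f (y + τ • w)) (fderiv ℝ f (y + τ • w) w) τ := by
        have hl : HasDerivAt (fun τ : ℝ => y + τ • w) w τ := by
          simpa using ((hasDerivAt_id τ).smul_const w).const_add y
        exact hτ.hasFDerivAt.comp_hasDerivAt τ hl
      rw [hd.deriv]
      refine hfd _ ?_ hτ
      rcases eq_or_lt_of_le hh with rfl | hpos
      · obtain rfl : τ = 0 := le_antisymm hmem.2 hmem.1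
        exact hyh
      have hc := (convex_ball z δ).add_smul_sub_mem hyb hyh
        (t := τ / h) ⟨div_nonneg hmem.1 hh, (div_le_one hpos).2 hmem.2⟩
      have e : (τ / h) • (y + h • w - y) = τ • w := by
        rw [add_sub_cancel_left, smul_smul, div_mul_cancel₀ _ hpos.ne']
      rwa [e] at hc)
    simpa [mul_comm] using this
  have hopen : IsOpen {y : G | y ∈ Metric.ball z δ ∧ y + h • w ∈ Metric.ball z δ} :=
    Metric.isOpen_ball.inter (Metric.isOpen_ball.preimage (continuous_add_const _))
  have hcl := (Measure.dense_of_ae hae).open_subset_closure_inter hopen ⟨hz, hzh⟩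
  have hclosed : IsClosed {y : G | f (y + h • w) - f y ≤ a * h} :=
    isClosed_le ((hf.continuous.comp (continuous_add_const _)).sub hf.continuous) continuous_const
  refine hclosed.closure_subset_iff.2 ?_ hcl
  rintro y ⟨⟨h1, h2⟩, h3⟩
  exact hgood y h3 h1 h2

/-- A directional derivative of a locally Lipschitz function is at most the support function of
the Clarke gradient. -/
theorem exists_mem_clarkeGradient_le {Ω : Set G} {V : G → ℝ} {z w : G} {d : ℝ} {K : NNReal}
    {s : Set G} (hs : s ∈ 𝓝 z) (hV : LipschitzOnWith K V s) (hz : z ∈ interior Ω)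
    (hd : HasLineDerivAt ℝ V d z w) : ∃ p ∈ clarkeGradient Ω V z, d ≤ p w := by
  obtain ⟨f, hf, hVf⟩ := hV.extend_real
  have hnear : ∀ η > 0, ∃ y ∈ Metric.ball z η, y ∈ interior Ω ∧ DifferentiableAt ℝ V y ∧
      ‖fderiv ℝ V y‖ ≤ K ∧ d - η < fderiv ℝ V y w := by
    intro η hη
    by_contra! hcon
    obtain ⟨δ, hδ, hball⟩ := Metric.mem_nhds_iff.1
      (inter_mem (inter_mem hs (isOpen_interior.mem_nhds hz)) (Metric.ball_mem_nhds z hη))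
    have heq : ∀ y ∈ Metric.ball z δ, V =ᶠ[𝓝 y] f := fun y hy => by
      filter_upwards [Metric.isOpen_ball.mem_nhds hy] with u hu using hVf (hball hu).1.1
    have hfd : ∀ y ∈ Metric.ball z δ, DifferentiableAt ℝ f y → fderiv ℝ f y w ≤ d - η := by
      intro y hy hdy
      have e := (heq y hy).fderiv_eq (𝕜 := ℝ)
      rw [← e]
      exact hcon y (hball hy).2 (hball hy).1.2 ((heq y hy).differentiableAt_iff.2 hdy)
        (e ▸ norm_fderiv_le_of_lipschitz ℝ hf)
    have hzb : z ∈ Metric.ball z δ := Metric.mem_ball_self hδ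
    -- The difference quotients at `z` tend to `d`, yet the gradient bound keeps them at most `d -
    -- η`.
    have hle : d ≤ d - η := by
      refine le_of_tendsto (HasDerivAt.tendsto_slope_zero_right hd) ?_
      have hc : ContinuousAt (fun h : ℝ => z + h • w) 0 := by fun_prop
      have hev : ∀ᶠ h in 𝓝 (0 : ℝ), z + h • w ∈ Metric.ball z δ :=
        hc.eventually_mem (by simpa using Metric.ball_mem_nhds z hδ)
      filter_upwards [hev.filter_mono nhdsWithin_le_nhds, self_mem_nhdsWithin] with h hh hpos
      have hpos : 0 < h := hpos
      have := sub_le_of_forall_fderiv_apply_le hf hfd hpos.le hzb hh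
      rw [← hVf (hball hh).1.1, ← hVf (hball hzb).1.1] at this
      simpa [← div_eq_inv_mul, div_le_iff₀ hpos] using this
    linarith
  choose! y hyb hyi hyd hyn hyw using hnear
  have hη : ∀ n : ℕ, (0 : ℝ) < 1 / ((n : ℝ) + 1) := fun n => by positivity
  obtain ⟨p, -, φ, hφ, hp⟩ := tendsto_subseq_of_bounded
    (x := fun n : ℕ => fderiv ℝ V (y (1 / ((n : ℝ) + 1))))
    (Metric.isBounded_closedBall (x := (0 : G →L[ℝ] ℝ)) (r := K))
    (fun n => by simpa using hyn _ (hη n))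
  have hη0 : Tendsto (fun n => 1 / ((φ n : ℝ) + 1)) atTop (𝓝 0) :=
    tendsto_one_div_add_atTop_nhds_zero_nat.comp hφ.tendsto_atTop
  refine ⟨p, subset_closedConvexHull ⟨fun n => y (1 / ((φ n : ℝ) + 1)),
    fun n => ⟨hyi _ (hη _), hyd _ (hη _)⟩, ?_, hp⟩, ?_⟩
  · rw [tendsto_iff_dist_tendsto_zero]
    exact squeeze_zero (fun _ => dist_nonneg) (fun n => (Metric.mem_ball.1 (hyb _ (hη _))).le) hη0
  · have hcont : Continuous fun q : G →L[ℝ] ℝ => q w :=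
      (ContinuousLinearMap.apply ℝ ℝ w).continuous
    have hl : Tendsto (fun n => d - 1 / ((φ n : ℝ) + 1)) atTop (𝓝 d) := by
      simpa using hη0.const_sub d
    exact le_of_tendsto_of_tendsto' hl ((hcont.tendsto p).comp hp) fun n => (hyw _ (hη _)).le

end Clarke

end DiffIncl

namespace DiffIncl

/-- **Barbalat's lemma**. -/
theorem tendsto_zero_of_integral_le {f : ℝ → ℝ} {s C : ℝ}
    (huc : UniformContinuousOn f (Set.Ici s)) (hf : ∀ t, s ≤ t → 0 ≤ f t)
    (hC : ∀ t, s ≤ t → ∫ u in s..t, f u ≤ C) : Tendsto f atTop (𝓝 0) := by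
  have hint : ∀ {a b : ℝ}, s ≤ a → s ≤ b → IntervalIntegrable f volume a b := fun ha hb =>
    (huc.continuousOn.mono fun u hu => (le_min ha hb).trans hu.1).intervalIntegrable
  have hI : IntegrableOn f (Set.Ioi s) := by
    refine integrableOn_Ioi_of_intervalIntegral_norm_bounded C s (b := id) (l := atTop) (fun t => ?_)
      tendsto_id ?_
    · rcases le_total s t with h | h
      · exact (intervalIntegrable_iff_integrableOn_Ioc_of_le h).1 (hint le_rfl h)
      · simp [Set.Ioc_eq_empty_of_le h]
    · filter_upwards [eventually_ge_atTop s] with t ht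
      refine le_of_eq_of_le (intervalIntegral.integral_congr fun u hu => ?_) (hC t ht)
      rw [id_eq, Set.uIcc_of_le ht] at hu
      exact Real.norm_of_nonneg (hf u hu.1)
  have hlim := intervalIntegral_tendsto_integral_Ioi s hI tendsto_id
  rw [Metric.tendsto_nhds]
  intro ε hε
  obtain ⟨δ, hδ, hδε⟩ := Metric.uniformContinuousOn_iff.1 huc (ε / 2) (half_pos hε)
  -- Integrals over windows of length `δ / 2` vanish in the limit, while `f ≥ f t - ε / 2` on the
  -- window starting at `t`.
  have hdiff : Tendsto (fun t => (∫ u in s..(t + δ / 2), f u) - ∫ u in s..t, f u) atTop (𝓝 0) := by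
    simpa using (hlim.comp (tendsto_atTop_add_const_right _ (δ / 2) tendsto_id)).sub hlim
  filter_upwards [hdiff.eventually_lt_const (show 0 < ε / 2 * (δ / 2) by positivity),
    eventually_ge_atTop s] with t ht hst
  rw [dist_zero_right, Real.norm_of_nonneg (hf t hst)]
  have hst' : s ≤ t + δ / 2 := by linarith
  rw [intervalIntegral.integral_interval_sub_left (hint le_rfl hst') (hint le_rfl hst)] at ht
  have hlow : (∫ _u in t..(t + δ / 2), (f t - ε / 2)) ≤ ∫ u in t..(t + δ / 2), f u := by
    refine intervalIntegral.integral_mono_on (by linarith) (by simp) (hint hst hst') fun u hu => ?_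
    have := hδε t hst u (hst.trans hu.1) (by
      rw [Real.dist_eq, abs_sub_comm, abs_of_nonneg (by linarith [hu.1])]; linarith [hu.2])
    rw [Real.dist_eq] at this
    linarith [(abs_lt.1 this).2]
  simp only [intervalIntegral.integral_const, smul_eq_mul, add_sub_cancel_left] at hlow
  have : (δ / 2) * (f t - ε / 2) < (δ / 2) * (ε / 2) := by linarith
  have := lt_of_mul_lt_mul_left this (by positivity)
  linarith

/-! ### Decrease of `V` along solutions -/

section Derivative

variable {E : Type*} [NormedAddCommGroup E] [NormedSpace ℝ E]

/-- A directional derivative of `V` in an admissible direction along which all the functions of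
the collection have directional derivatives is at most the generalized derivative. -/
theorem le_genDeriv [FiniteDimensional ℝ E] {Ω : Set (E × ℝ)} {F : E → ℝ → Set E}
    {U : ℕ → E × ℝ → ℝ} {V : E × ℝ → ℝ} {x v : E} {t d : ℝ} {K : NNReal} {s : Set (E × ℝ)}
    (hv : v ∈ F x t) (hint : (x, t) ∈ interior Ω) (hUreg : ∀ i, IsRegularOn Ω (U i))
    (hU : ∀ i, ∃ e, HasLineDerivAt ℝ (U i) e (x, t) (v, 1)) (hs : s ∈ 𝓝 (x, t))
    (hVlip : LipschitzOnWith K V s) (hV : HasLineDerivAt ℝ V d (x, t) (v, 1)) :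
    (d : EReal) ≤ genDeriv Ω F U V x t := by
  have hred : v ∈ reducedInclusion Ω F U x t := by
    refine Set.mem_iInter.2 fun i => ⟨hv, ?_⟩
    obtain ⟨e, he⟩ := hU i
    exact ⟨e, fun p hp => apply_eq_of_mem_clarkeGradient (hUreg i _ hint) he hp⟩
  have hsup : ∀ p : E × ℝ →L[ℝ] ℝ, ((p (v, 1) : ℝ) : EReal) ≤
      ⨆ q ∈ reducedInclusion Ω F U x t, ((p (q, 1) : ℝ) : EReal) := fun p =>
    le_iSup₂ (f := fun q (_ : q ∈ reducedInclusion Ω F U x t) => ((p (q, 1) : ℝ) : EReal)) v hred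
  rw [genDeriv, if_neg (Set.nonempty_of_mem hred).ne_empty]
  -- For regular `V` all gradients give exactly `d`, so the minimum is harmless; otherwise one
  -- dominating gradient suffices for the maximum.
  split_ifs with hreg
  · refine le_iInf₂ fun p hp => ?_
    rw [← apply_eq_of_mem_clarkeGradient (hreg _ hint) hV hp]
    exact hsup p
  · obtain ⟨p, hp, hdp⟩ := exists_mem_clarkeGradient_le hs hVlip hint hV
    exact (EReal.coe_le_coe_iff.2 hdp).trans ((hsup p).trans (le_iSup₂ (f := fun p
      (_ : p ∈ clarkeGradient Ω V (x, t)) =>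
        ⨆ q ∈ reducedInclusion Ω F U x t, ((p (q, 1) : ℝ) : EReal)) p hp))

/-- A locally Lipschitz function is absolutely continuous along an absolutely continuous curve. -/
theorem absolutelyContinuousOnInterval_comp_curve {X : Type*} [NormedAddCommGroup X]
    {D : Set X} {t₀ : ℝ} {V : X × ℝ → ℝ}
    (hV : LocallyLipschitzOn (D ×ˢ Set.Ici t₀) V) {x : ℝ → X} {a b : ℝ} (hab : a ≤ b)
    (ha : t₀ ≤ a) (hx : AbsolutelyContinuousOnInterval x a b) (hxD : ∀ t ∈ Set.Icc a b, x t ∈ D) :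
    AbsolutelyContinuousOnInterval (fun t => V (x t, t)) a b := by
  have hc : ContinuousOn (fun t => (x t, t)) (Set.Icc a b) :=
    (Set.uIcc_of_le hab ▸ hx.continuousOn).prodMk continuousOn_id
  have hsub : (fun t => (x t, t)) '' Set.Icc a b ⊆ D ×ˢ Set.Ici t₀ := by
    rintro _ ⟨t, ht, rfl⟩
    exact ⟨hxD t ht, ha.trans ht.1⟩
  obtain ⟨K, hK⟩ := (hV.mono hsub).exists_lipschitzOnWith_of_compact
    (isCompact_Icc.image_of_continuousOn hc)
  refine absolutelyContinuousOnInterval_of_dist_le hx K K fun u hu v hv => ?_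
  rw [Set.uIcc_of_le hab] at hu hv
  refine (hK.dist_le_mul _ ⟨u, hu, rfl⟩ _ ⟨v, hv, rfl⟩).trans ?_
  rw [← mul_add]
  gcongr
  rw [Prod.dist_eq, add_comm]
  exact max_le_add_of_nonneg dist_nonneg dist_nonneg

/-- Along a solution the derivative of `V` is almost everywhere at most the generalized
derivative. -/
theorem ae_deriv_le_genDeriv [FiniteDimensional ℝ E] {D : Set E} {t₀ : ℝ} (hD : IsOpen D)
    {F : E → ℝ → Set E} {U : ℕ → E × ℝ → ℝ} {V : E × ℝ → ℝ}
    (hUlip : ∀ i, LocallyLipschitzOn (D ×ˢ Set.Ici t₀) (U i))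
    (hUreg : ∀ i, IsRegularOn (D ×ˢ Set.Ici t₀) (U i))
    (hVlip : LocallyLipschitzOn (D ×ˢ Set.Ici t₀) V) {x : ℝ → E} {a b : ℝ} (hab : a ≤ b)
    (ha : t₀ ≤ a) (hx : AbsolutelyContinuousOnInterval x a b) (hxD : ∀ t ∈ Set.Icc a b, x t ∈ D)
    (hxF : ∀ᵐ t : ℝ, t ∈ Set.Icc a b → ∃ v ∈ F (x t) t, HasDerivAt x v t) :
    ∀ᵐ t : ℝ, t ∈ Set.Icc a b →
      ((deriv (fun t => V (x t, t)) t : ℝ) : EReal) ≤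
        genDeriv (D ×ˢ Set.Ici t₀) F U V (x t) t := by
  have hdiff : ∀ {Z : E × ℝ → ℝ}, LocallyLipschitzOn (D ×ˢ Set.Ici t₀) Z →
      ∀ᵐ t : ℝ, t ∈ Set.Icc a b → DifferentiableAt ℝ (fun t => Z (x t, t)) t := fun hZ => by
    have := (absolutelyContinuousOnInterval_comp_curve hZ hab ha hx hxD).ae_differentiableAt
    rwa [Set.uIcc_of_le hab] at this
  -- The time `a` is discarded because `a = t₀` would put the point on the boundary of the domain.
  filter_upwards [hxF, ae_all_iff.2 fun i => hdiff (hUlip i), hdiff hVlip,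
    Measure.ae_ne volume a] with t hF hUt hVt hne ht
  obtain ⟨v, hv, hxv⟩ := hF ht
  have hint : (x t, t) ∈ interior (D ×ˢ Set.Ici t₀) := by
    rw [interior_prod_eq, interior_Ici, hD.interior_eq]
    exact ⟨hxD t ht, ha.trans_lt (lt_of_le_of_ne ht.1 hne.symm)⟩
  have hγ : HasDerivAt (fun t => (x t, t)) (v, (1 : ℝ)) t := hxv.prodMk (hasDerivAt_id t)
  have hloc : ∀ {Z : E × ℝ → ℝ}, LocallyLipschitzOn (D ×ˢ Set.Ici t₀) Z →
      ∃ K : NNReal, ∃ s ∈ 𝓝 (x t, t), LipschitzOnWith K Z s := fun hZ => by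
    obtain ⟨K, s, hs, hK⟩ := hZ (interior_subset hint)
    rw [nhdsWithin_eq_nhds.2 (mem_interior_iff_mem_nhds.1 hint)] at hs
    exact ⟨K, s, hs, hK⟩
  obtain ⟨K, s, hs, hK⟩ := hloc hVlip
  refine le_genDeriv hv hint hUreg (fun i => ?_) hs hK
    (hasLineDerivAt_of_hasDerivAt_comp (γ := fun t => (x t, t)) hs hK hγ
      (hVt ht).hasDerivAt)
  obtain ⟨K', s', hs', hK'⟩ := hloc (hUlip i)
  exact ⟨_, hasLineDerivAt_of_hasDerivAt_comp (γ := fun t => (x t, t)) hs' hK' hγ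
    (hUt i ht).hasDerivAt⟩

/-- The integrated decrease of `V` along a solution. -/
theorem add_integral_le_of_genDeriv_le [FiniteDimensional ℝ E] {D : Set E} {t₀ : ℝ}
    (hD : IsOpen D) {F : E → ℝ → Set E} {U : ℕ → E × ℝ → ℝ} {V : E × ℝ → ℝ} {W : E → ℝ}
    (hUlip : ∀ i, LocallyLipschitzOn (D ×ˢ Set.Ici t₀) (U i))
    (hUreg : ∀ i, IsRegularOn (D ×ˢ Set.Ici t₀) (U i))
    (hVlip : LocallyLipschitzOn (D ×ˢ Set.Ici t₀) V) (hW : ContinuousOn W D)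
    (hVdecr : ∀ᵐ t : ℝ, t₀ ≤ t → ∀ x ∈ D,
      genDeriv (D ×ˢ Set.Ici t₀) F U V x t ≤ ((-W x : ℝ) : EReal))
    {x : ℝ → E} {s : ℝ} {T : EReal} (hx : IsSolution F x s T) (hs : t₀ ≤ s) {b : ℝ}
    (hb : b ∈ timeInterval s T) (hxD : ∀ t ∈ Set.Icc s b, x t ∈ D) :
    V (x b, b) + ∫ t in s..b, W (x t) ≤ V (x s, s) := by
  have hsub : Set.Icc s b ⊆ timeInterval s T := fun t ht =>
    ⟨ht.1, (EReal.coe_le_coe_iff.2 ht.2).trans_lt hb.2⟩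
  have hac := hx.2.1 s b hb.1 hsub
  have hWc : ContinuousOn (fun t => W (x t)) (Set.uIcc s b) :=
    hW.comp hac.continuousOn fun t ht => hxD t (Set.uIcc_of_le hb.1 ▸ ht)
  have hder := ae_deriv_le_genDeriv hD hUlip hUreg hVlip hb.1 hs hac hxD
    (hx.2.2.mono fun t ht hmem => ht (hsub hmem))
  have := sub_le_integral_of_deriv_le (g := fun t => -W (x t)) hb.1
    (absolutelyContinuousOnInterval_comp_curve hVlip hb.1 hs hac hxD) hWc.neg.intervalIntegrable (by
    filter_upwards [hder, hVdecr] with t h1 h2 ht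
    exact EReal.coe_le_coe_iff.1 ((h1 ht).trans (h2 (hs.trans ht.1) _ (hxD t ht))))
  rw [intervalIntegral.integral_neg] at this
  linarith

end Derivative

/-! ### Confinement and continuation of solutions -/

section Solutions

variable {E : Type*} [NormedAddCommGroup E] [NormedSpace ℝ E]

/-- A continuous curve that starts inside a ball and cannot reach its boundary while it stays in
the closed ball remains inside. -/
theorem norm_lt_of_forall_norm_ne {X : Type*} [NormedAddCommGroup X] {x : ℝ → X} {s b r : ℝ}
    (hsb : s ≤ b)
    (hx : ContinuousOn x (Set.Icc s b)) (hs : ‖x s‖ < r)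
    (h : ∀ t ∈ Set.Icc s b, (∀ u ∈ Set.Icc s t, ‖x u‖ ≤ r) → ‖x t‖ ≠ r) : ‖x b‖ < r := by
  by_contra! hb
  have hclosed : IsClosed {t | t ∈ Set.Icc s b ∧ r ≤ ‖x t‖} := by
    have := hx.norm.preimage_isClosed_of_isClosed isClosed_Icc (isClosed_Ici (a := r))
    exact this
  have hcomp : IsCompact {t | t ∈ Set.Icc s b ∧ r ≤ ‖x t‖} :=
    isCompact_Icc.of_isClosed_subset hclosed fun t ht => ht.1
  -- At the first time with `r ≤ ‖x t‖`, the norm equals `r` by the intermediate value theorem.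
  obtain ⟨t, ⟨htm, htr⟩, hmin⟩ := hcomp.exists_isLeast ⟨b, ⟨hsb, le_rfl⟩, hb⟩
  obtain ⟨u, hu, hur⟩ := intermediate_value_Icc htm.1
    (hx.norm.mono (Set.Icc_subset_Icc_right htm.2)) (show r ∈ Set.Icc ‖x s‖ ‖x t‖ from ⟨hs.le, htr⟩)
  have hur : ‖x u‖ = r := hur
  obtain rfl : u = t := le_antisymm hu.2 (hmin ⟨⟨hu.1, hu.2.trans htm.2⟩, hur.ge⟩)
  refine h u htm (fun v hv => ?_) hur
  rcases eq_or_lt_of_le hv.2 with rfl | hlt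
  · exact hur.le
  · by_contra! hc
    exact absurd (hmin ⟨⟨hv.1, hv.2.trans htm.2⟩, hc.le⟩) (not_le.2 hlt)

/-- A solution that stays in a set on which the inclusion is bounded is Lipschitz. -/
theorem IsSolution.exists_lipschitzOnWith {F : E → ℝ → Set E} {x : ℝ → E} {s : ℝ} {T : EReal}
    (hx : IsSolution F x s T) {K : Set E} {M : ℝ} (hM : 0 ≤ M)
    (hF : ∀ y ∈ K, ∀ t, s ≤ t → ∀ v ∈ F y t, ‖v‖ ≤ M) (hxK : ∀ t ∈ timeInterval s T, x t ∈ K) :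
    ∃ C : NNReal, LipschitzOnWith C x (timeInterval s T) := by
  refine ⟨⟨M, hM⟩, LipschitzOnWith.of_dist_le_mul ?_⟩
  have key : ∀ u ∈ timeInterval s T, ∀ v ∈ timeInterval s T, u ≤ v →
      dist (x u) (x v) ≤ M * (v - u) := by
    intro u hu v hv huv
    have hsub : Set.Icc u v ⊆ timeInterval s T := fun t ht =>
      ⟨hu.1.trans ht.1, (EReal.coe_le_coe_iff.2 ht.2).trans_lt hv.2⟩
    refine dist_le_of_ae_norm_deriv_le huv (hx.2.1 u v huv hsub) ?_
    filter_upwards [hx.2.2] with t ht hmem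
    obtain ⟨w, hw, hd⟩ := ht (hsub hmem)
    exact ⟨w, hd, hF _ (hxK t (hsub hmem)) t (hsub hmem).1 w hw⟩
  intro u hu v hv
  rcases le_total u v with h | h
  · rw [dist_comm u v, Real.dist_eq, abs_of_nonneg (sub_nonneg.2 h)]
    exact key u hu v hv h
  · rw [dist_comm (x u), Real.dist_eq, abs_of_nonneg (sub_nonneg.2 h)]
    exact key v hv u hu h

/-- Concatenation of a solution that is Lipschitz up to its end time with a solution that starts
where it ends. -/
theorem IsSolution.concat {F : E → ℝ → Set E} {x g z : ℝ → E} {s T T' : ℝ}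
    (hx : IsSolution F x s (T : EReal)) {C : NNReal} (hg : LipschitzWith C g)
    (hxg : Set.EqOn x g (timeInterval s (T : EReal))) (hz : IsSolution F z T (T' : EReal))
    (hzg : z T = g T) :
    IsSolution F (fun t => if t < T then x t else z t) s (T' : EReal) := by
  have hsT : s < T := EReal.coe_lt_coe_iff.1 hx.1
  have hTT' : T < T' := EReal.coe_lt_coe_iff.1 hz.1
  refine ⟨EReal.coe_lt_coe_iff.2 (hsT.trans hTT'), fun a b hab hsub => ?_, ?_⟩
  · have ha := hsub (Set.left_mem_Icc.2 hab)
    have hb := hsub (Set.right_mem_Icc.2 hab)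
    have hzac : AbsolutelyContinuousOnInterval z T (max b T) :=
      hz.2.1 T (max b T) (le_max_right _ _) fun t ht =>
        ⟨ht.1, EReal.coe_lt_coe_iff.2 (ht.2.trans_lt (max_lt (EReal.coe_lt_coe_iff.1 hb.2) hTT'))⟩
    -- One formula for both pieces: a Lipschitz function of time plus an absolutely continuous one
    -- frozen before `T`.
    have hform : ∀ u, s ≤ u →
        (if u < T then x u else z u) = g (min u T) + (z (max u T) - z T) := by
      intro u hu
      split_ifs with h
      · rw [min_eq_left h.le, max_eq_right h.le, sub_self, add_zero]
        exact hxg ⟨hu, EReal.coe_lt_coe_iff.2 h⟩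
      · rw [min_eq_right (not_lt.1 h), max_eq_left (not_lt.1 h), hzg]
        abel
    refine absolutelyContinuousOnInterval_of_dist_le
      (absolutelyContinuousOnInterval_comp_max hab hzac) C 1 fun u hu v hv => ?_
    rw [Set.uIcc_of_le hab] at hu hv
    rw [hform u (ha.1.trans hu.1), hform v (ha.1.trans hv.1), one_mul]
    refine (dist_add_add_le _ _ _ _).trans (add_le_add ?_ (dist_sub_right _ _ _).le)
    refine (hg.dist_le_mul _ _).trans ?_
    gcongr
    simpa [Real.dist_eq] using abs_min_sub_min_le_max u T v T
  · filter_upwards [hx.2.2, hz.2.2, Measure.ae_ne volume T] with t h1 h2 hne ht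
    rcases lt_or_gt_of_ne hne with h | h
    · obtain ⟨v, hv, hd⟩ := h1 ⟨ht.1, EReal.coe_lt_coe_iff.2 h⟩
      refine ⟨v, by simpa [h] using hv, hd.congr_of_eventuallyEq ?_⟩
      filter_upwards [Iio_mem_nhds h] with u hu using if_pos hu
    · obtain ⟨v, hv, hd⟩ := h2 ⟨h.le, ht.2⟩
      refine ⟨v, by simpa [not_lt.2 h.le] using hv, hd.congr_of_eventuallyEq ?_⟩
      filter_upwards [Ioi_mem_nhds h] with u hu using if_neg (not_lt.2 (le_of_lt hu))

/-- A maximal solution that is Lipschitz and stays in a closed subset of the domain is complete. -/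
theorem IsMaximalSolution.eq_top [FiniteDimensional ℝ E] {F : E → ℝ → Set E} {D K : Set E}
    {t₀ s : ℝ} {T : EReal} {x : ℝ → E} (hF : AdmitsLocalSolutions F D (Set.Ici t₀))
    (hx : IsMaximalSolution F x s T) (hs : t₀ ≤ s) (hK : IsClosed K) (hKD : K ⊆ D)
    (hxK : ∀ t ∈ timeInterval s T, x t ∈ K) {C : NNReal}
    (hlip : LipschitzOnWith C x (timeInterval s T)) : T = ⊤ := by
  by_contra hT
  lift T to ℝ using ⟨hT, ((EReal.bot_lt_coe s).trans hx.1.1).ne'⟩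
  have hsT : s < T := EReal.coe_lt_coe_iff.1 hx.1.1
  -- The Lipschitz extension supplies the limit of `x` at `T`, from which a local solution
  -- continues.
  obtain ⟨g, hg, hxg⟩ := hlip.extend_finite_dimension
  have hgT : g T ∈ K := by
    have hsub : Set.Ico s T ⊆ g ⁻¹' K := fun t ht => by
      have htm : t ∈ timeInterval s (T : EReal) := ⟨ht.1, EReal.coe_lt_coe_iff.2 ht.2⟩
      rw [Set.mem_preimage, ← hxg htm]
      exact hxK t htm
    refine (hK.preimage hg.continuous).closure_subset_iff.2 hsub ?_
    rw [closure_Ico hsT.ne]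
    exact Set.right_mem_Icc.2 hsT.le
  obtain ⟨T', z, hTT', hzT, hz⟩ := hF (g T) (hKD hgT) T (hs.trans hsT.le)
  refine hx.2 ⟨T', _, EReal.coe_lt_coe_iff.2 hTT', hx.1.concat hg hxg hz hzT, fun t ht => ?_⟩
  exact if_pos (EReal.coe_lt_coe_iff.1 ht.2)

end Solutions

end DiffIncl

/-! ### The invariance-like theorem -/

theorem mainTheorem6 (n : ℕ) (t₀ : ℝ)
    (D : Set (EuclideanSpace ℝ (Fin n))) (hDopen : IsOpen D) (hDconn : IsConnected D)
    (hD0 : (0 : EuclideanSpace ℝ (Fin n)) ∈ D)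
    (F : EuclideanSpace ℝ (Fin n) → ℝ → Set (EuclideanSpace ℝ (Fin n)))
    (hFcompact : ∀ x, ∀ t, t₀ ≤ t → IsCompact (F x t))
    (hFsol : DiffIncl.AdmitsLocalSolutions F D (Set.Ici t₀))
    (hFbdd : DiffIncl.LocallyBoundedUniformly F D t₀)
    (U : ℕ → EuclideanSpace ℝ (Fin n) × ℝ → ℝ)
    (hUlip : ∀ i, LocallyLipschitzOn (D ×ˢ Set.Ici t₀) (U i))
    (hUreg : ∀ i, DiffIncl.IsRegularOn (D ×ˢ Set.Ici t₀) (U i))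
    (V : EuclideanSpace ℝ (Fin n) × ℝ → ℝ)
    (hVlip : LocallyLipschitzOn (D ×ˢ Set.Ici t₀) V)
    (hVpos : ∀ t, t₀ ≤ t → DiffIncl.PosDefOn D (fun x => V (x, t)))
    (Wlow Wup W : EuclideanSpace ℝ (Fin n) → ℝ)
    (hWlow : ContinuousOn Wlow D) (hWlowpos : DiffIncl.PosDefOn D Wlow)
    (hWup : ContinuousOn Wup D) (hWuppos : DiffIncl.PosDefOn D Wup)
    (hW : ContinuousOn W D) (hWnonneg : ∀ x ∈ D, 0 ≤ W x)
    (hVbounds : ∀ x ∈ D, ∀ t, t₀ ≤ t → Wlow x ≤ V (x, t) ∧ V (x, t) ≤ Wup x)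
    (hVdecr : ∀ᵐ t : ℝ, t₀ ≤ t → ∀ x ∈ D,
      DiffIncl.genDeriv (D ×ˢ Set.Ici t₀) F U V x t ≤ ((-W x : ℝ) : EReal))
    (r : ℝ) (hr : 0 < r) (hrD : Metric.closedBall 0 r ⊆ D)
    (c : ℝ) (hc0 : 0 ≤ c) (hc : ∀ x, ‖x‖ = r → c < Wlow x)
    (s : ℝ) (hs : t₀ ≤ s) (T : EReal) (x : ℝ → EuclideanSpace ℝ (Fin n))
    (hx : DiffIncl.IsMaximalSolution F x s T)
    (hxs : x s ∈ {y | y ∈ Metric.closedBall 0 r ∧ Wup y ≤ c}) :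
    T = ⊤ ∧
      (∀ t ∈ DiffIncl.timeInterval s T, x t ∈ D) ∧
      Bornology.IsBounded (x '' DiffIncl.timeInterval s T) ∧
      Tendsto (fun t => W (x t)) atTop (𝓝 0) := by
  have hsol := hx.1
  have hDball : ∀ {y}, ‖y‖ ≤ r → y ∈ D := fun hy => hrD (mem_closedBall_zero_iff.2 hy)
  have hsm : s ∈ DiffIncl.timeInterval s T := ⟨le_rfl, hsol.1⟩
  have hxsr : ‖x s‖ ≤ r := mem_closedBall_zero_iff.1 hxs.1
  have hVs : V (x s, s) ≤ c := (hVbounds _ (hDball hxsr) s hs).2.trans hxs.2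
  have hsub : ∀ {b}, b ∈ DiffIncl.timeInterval s T → Set.Icc s b ⊆ DiffIncl.timeInterval s T :=
    fun hb t ht => ⟨ht.1, (EReal.coe_le_coe_iff.2 ht.2).trans_lt hb.2⟩
  have hdecr : ∀ b ∈ DiffIncl.timeInterval s T, (∀ t ∈ Set.Icc s b, ‖x t‖ ≤ r) →
      V (x b, b) + ∫ t in s..b, W (x t) ≤ V (x s, s) := fun b hb h =>
    DiffIncl.add_integral_le_of_genDeriv_le hDopen hUlip hUreg hVlip hW hVdecr hsol hs hb
      fun t ht => hDball (h t ht)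
  have hne : ∀ b ∈ DiffIncl.timeInterval s T, (∀ t ∈ Set.Icc s b, ‖x t‖ ≤ r) → ‖x b‖ ≠ r := by
    intro b hb h hbr
    have h1 := hdecr b hb h
    have h2 : 0 ≤ ∫ t in s..b, W (x t) :=
      intervalIntegral.integral_nonneg hb.1 fun t ht => hWnonneg _ (hDball (h t ht))
    have h3 := (hVbounds _ (hDball hbr.le) b (hs.trans hb.1)).1
    linarith [hc _ hbr]
  have hball : ∀ t ∈ DiffIncl.timeInterval s T, ‖x t‖ < r := by
    intro b hb
    -- `hne` on the degenerate interval `[s, s]` shows that the start is strictly inside the ball.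
    refine DiffIncl.norm_lt_of_forall_norm_ne hb.1 ?_ (hxsr.lt_of_ne (hne s hsm ?_))
      fun t ht => hne t (hsub hb ht)
    · have := (hsol.2.1 s b hb.1 (hsub hb)).continuousOn
      rwa [Set.uIcc_of_le hb.1] at this
    · intro t ht
      obtain rfl : t = s := le_antisymm ht.2 ht.1
      exact hxsr
  have hK : IsCompact (Metric.closedBall (0 : EuclideanSpace ℝ (Fin n)) r) := isCompact_closedBall 0 r
  have hxK : ∀ t ∈ DiffIncl.timeInterval s T, x t ∈ Metric.closedBall 0 r := fun t ht =>
    mem_closedBall_zero_iff.2 (hball t ht).le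
  obtain ⟨M, hM, hMF⟩ := hFbdd _ hK hrD
  obtain ⟨C, hC⟩ := hsol.exists_lipschitzOnWith hM.le
    (fun y hy t ht => hMF y hy t (hs.trans ht)) hxK
  obtain rfl : T = ⊤ := hx.eq_top hFsol hs hK.isClosed hrD hxK hC
  have hI : DiffIncl.timeInterval s ⊤ = Set.Ici s := by
    ext t
    simp [DiffIncl.timeInterval]
  refine ⟨rfl, fun t ht => hrD (hxK t ht), hK.isBounded.subset (Set.image_subset_iff.2 hxK), ?_⟩
  rw [hI] at hxK hC hdecr hball
  refine DiffIncl.tendsto_zero_of_integral_le (s := s) (C := c) ?_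
    (fun t ht => hWnonneg _ (hrD (hxK t ht))) fun t ht => ?_
  · exact (hK.uniformContinuousOn_of_continuous (hW.mono hrD)).comp hC.uniformContinuousOn hxK
  · have h1 := hdecr t ht fun u hu => (hball u hu.1).le
    have h2 := (hVbounds _ (hrD (hxK t ht)) t (hs.trans ht)).1
    have h3 : 0 ≤ Wlow (x t) := by
      rcases eq_or_ne (x t) 0 with h | h
      · rw [h, hWlowpos.1]
      · exact (hWlowpos.2 _ (hrD (hxK t ht)) h).le
    linarith
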